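/- Let $d$ be an odd prime, $n$ a non-negative integer, $\omega=e^{2\pi i/d}$ and $\tau=e^{(d+1)\pi i/d}$. On $\mathbb{C}^d$ with computational basis $|j\rangle$, $j\in\mathbb{Z}_d$, let $X|j\rangle=|j+1\rangle$ and $Z|j\rangle=\omega^j|j\rangle$, and for $u=(a,b)\in\mathbb{Z}_d^n\times\mathbb{Z}_d^n$ let $T_u=\bigotimes_{k=1}^n \tau^{-a_kb_k}Z^{a_k}X^{b_k}$ be the Heisenberg--Weyl operators on $(\mathbb{C}^d)^{\otimes n}$. Let $A_0=d^{-n}\sum_u T_u$ and $A_u=T_uA_0T_u^\dagger$ be the phase-space point operators. Let $U$ be a unitary operator on $(\mathbb{C}^d)^{\otimes n}$ and $\mathcal{U}(\rho)=U\rho U^\dagger$ the corresponding unitary channel. Its discrete Wigner function is $W_{\mathcal U}(v|u)=d^{-n}\,\mathrm{tr}\big(A_v\,\mathcal{U}(A_u)\big)$ for $u,v\in\mathbb{Z}_d^n\times\mathbb{Z}_d^n$, its Wigner rank $\chi(\mathcal U)$ is the number of pairs $(v,u)$ with $W_{\mathcal U}(v|u)\neq 0$, and its logarithmic Wigner rank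 is $\chi_{\log}(\mathcal U)=\log_2\chi(\mathcal U)-\log_2 d^{2n}$. Then $\chi_{\log}(\mathcal U)\ge 0$. Moreover, $\chi_{\log}(\mathcal U)=0$ if and only if $\mathcal U$ is a Clifford operation, i.e. for every $u\in\mathbb{Z}_d^n\times\mathbb{Z}_d^n$ there are $\theta\in\mathbb{R}$ and $u'\in\mathbb{Z}_d^n\times\mathbb{Z}_d^n$ with $UT_uU^\dagger=e^{i\theta}T_{u'}$. -/

import Mathlib

open Matrix
open scoped Matrix

noncomputable section

namespace WignerRank

/-- Computational basis labels of `n` qudits of dimension `d`: the strings in `ℤ_d^n`. -/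
abbrev Label (d n : ℕ) : Type := Fin n → ZMod d

/-- Linear operators on the `n`-fold tensor power of `ℂ^d`, as matrices in the computational
(product) basis. -/
abbrev Operator (d n : ℕ) : Type := Matrix (Label d n) (Label d n) ℂ

/-- The discrete phase space `ℤ_d^n × ℤ_d^n`. -/
abbrev PhaseSpace (d n : ℕ) : Type := (Fin n → ZMod d) × (Fin n → ZMod d)

/-- `ω = exp(2πi/d)`. -/
def omega (d : ℕ) : ℂ := Complex.exp (2 * Real.pi * Complex.I / d)

/-- `τ = exp((d+1)πi/d)`. -/
def tau (d : ℕ) : ℂ := Complex.exp ((d + 1) * Real.pi * Complex.I / d)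

/-- The shift operator, `X |j⟩ = |j + 1⟩` (addition modulo `d`). -/
def shiftX (d : ℕ) : Matrix (ZMod d) (ZMod d) ℂ :=
  Matrix.of fun i j => if i = j + 1 then 1 else 0

/-- The boost operator, `Z |j⟩ = ω^j |j⟩`. -/
def boostZ (d : ℕ) : Matrix (ZMod d) (ZMod d) ℂ :=
  Matrix.diagonal fun j => omega d ^ j.val

/-- The one-qudit Heisenberg–Weyl operator `τ^(-a₁ a₂) Z^{a₁} X^{a₂}`, where `a₁, a₂` are
represented by integers in `{0, …, d-1}`. -/
def weyl₁ (d : ℕ) [NeZero d] (a₁ a₂ : ZMod d) : Matrix (ZMod d) (ZMod d) ℂ :=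
  tau d ^ (-((a₁.val * a₂.val : ℕ) : ℤ)) • (boostZ d ^ a₁.val * shiftX d ^ a₂.val)

/-- The `n`-qudit Heisenberg–Weyl operator `T_u`: the tensor product over the `n` qudits of the
one-qudit operators at `(u.1 k, u.2 k)`, written out in the product basis. -/
def weyl {d n : ℕ} [NeZero d] (u : PhaseSpace d n) : Operator d n :=
  Matrix.of fun i j => ∏ k, weyl₁ d (u.1 k) (u.2 k) (i k) (j k)

/-- `A_0 = d^{-n} ∑_u T_u`. -/
def phasePointZero (d n : ℕ) [NeZero d] : Operator d n :=
  (1 / (d : ℂ) ^ n) • ∑ u : PhaseSpace d n, weyl u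

/-- The phase-space point operator `A_u = T_u A_0 T_u†`. -/
def phasePoint {d n : ℕ} [NeZero d] (u : PhaseSpace d n) : Operator d n :=
  weyl u * phasePointZero d n * (weyl u)ᴴ

/-- The discrete Wigner function `W_N(v|u) = d^{-n} tr(A_v N(A_u))` of a linear map `N` on
`n`-qudit operators. -/
def channelWigner {d n : ℕ} [NeZero d] (N : Operator d n →ₗ[ℂ] Operator d n)
    (v u : PhaseSpace d n) : ℂ :=
  1 / (d : ℂ) ^ n * (phasePoint v * N (phasePoint u)).trace

/-- The set of pairs `(v, u)` with `W_N(v|u) ≠ 0`. -/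
def wignerSet {d n : ℕ} [NeZero d] (N : Operator d n →ₗ[ℂ] Operator d n) :
    Set (PhaseSpace d n × PhaseSpace d n) :=
  {p | channelWigner N p.1 p.2 ≠ 0}

/-- The Wigner rank `χ(N)`: the number of nonzero Wigner coefficients. -/
def wignerRank {d n : ℕ} [NeZero d] (N : Operator d n →ₗ[ℂ] Operator d n) : ℕ :=
  (wignerSet N).ncard

/-- The logarithmic Wigner rank `χ_log(N) = log χ(N) - log d^{2n}`, logarithms to base 2. -/
def logWignerRank {d n : ℕ} [NeZero d] (N : Operator d n →ₗ[ℂ] Operator d n) : ℝ :=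
  Real.logb 2 (wignerRank N) - Real.logb 2 ((d : ℝ) ^ (2 * n))

/-- The linear map `ρ ↦ U ρ U†`; for unitary `U` it is the unitary channel of `U`. -/
def conjChannel {d n : ℕ} [NeZero d] (U : Operator d n) :
    Operator d n →ₗ[ℂ] Operator d n :=
  LinearMap.mulLeft ℂ U ∘ₗ LinearMap.mulRight ℂ Uᴴ

theorem conjChannel_apply {d n : ℕ} [NeZero d] (U ρ : Operator d n) :
    conjChannel U ρ = U * ρ * Uᴴ := by
  simp [conjChannel, Matrix.mul_assoc]

/-- Clifford operators: unitaries that map every Heisenberg–Weyl operator to a Heisenberg–Weyl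
operator, up to a phase, under conjugation. -/
def cliffordOperators (d n : ℕ) [NeZero d] : Set (Operator d n) :=
  {U | U ∈ Matrix.unitaryGroup (Label d n) ℂ ∧
    ∀ u : PhaseSpace d n, ∃ (θ : ℝ) (u' : PhaseSpace d n),
      U * weyl u * Uᴴ = Complex.exp (θ * Complex.I) • weyl u'}

end WignerRank

end

/-!
For odd `d` the operator `A_0` is the parity operator `P : |j⟩ ↦ |-j⟩`
(`phasePointZero_eq_parity`). Parity satisfies `P T_u = T_{-u} P`, so `A_u = T_{2u} P`, each `A_u`
squares to one, and `A_u A_v` is a phase times `T_{2u - 2v}`. As a nontrivial Weyl operator has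
trace zero, the `d ^ (2n)` operators `A_u` are orthogonal for the trace form and form a basis of
the space of operators. The column `W(· | u)` of the Wigner function of a unitary channel consists
of the coefficients of `U A_u U†` in this basis (`conj_phasePoint_eq_sum`). Since `U A_u U†` is not
zero, every column has a nonzero entry. Hence the Wigner rank is at least the number `d ^ (2n)` of
columns, with equality exactly when every column has a single nonzero entry
(`wignerRank_eq_iff`).

In the case of equality every `U A_u U†` is a multiple of some `A_v`. Every Weyl operator is of the
form `T_{2u} = A_u A_0`, so `U T_{2u} U†` is a multiple of a product of two phase-space point
operators, hence of a Weyl operator, and unitarity makes the factor a phase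
(`mem_cliffordOperators_of_conj_phasePoint`).

Conversely, let `U` be Clifford and `B = U A_u U†`. Conjugation by `B` sends each `T_x` to a
multiple of `T_{-x}`, as does conjugation by any `A_v`, so `A_v B` commutes with all `T_x` up to
scalars. If `W(v | u) ≠ 0`, then `A_v B` has nonzero trace and these scalars are one. For two
nonzero entries `v`, `w` of one column, `A_v A_w = (A_v B) (A_w B)⁻¹` therefore commutes with all
Weyl operators. It is proportional to `T_{2v - 2w}`, which forces `v = w`
(`injOn_snd_wignerSet_of_clifford`).
-/

namespace WignerRank

variable {d n : ℕ}

/-! ### Halving and the symplectic form on phase space -/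

/-- The inverse of `2` in `ZMod d` for odd `d`. -/
def half (d : ℕ) : ZMod d := (((d + 1) / 2 : ℕ) : ZMod d)

theorem two_mul_half (hd : Odd d) : 2 * half d = 1 := by
  obtain ⟨k, rfl⟩ := hd
  have h : (2 * k + 1 + 1) / 2 = k + 1 := by omega
  have h0 : ((2 * k + 1 : ℕ) : ZMod (2 * k + 1)) = 0 := ZMod.natCast_self _
  rw [half, h]
  push_cast at h0 ⊢
  linear_combination h0

/-- Phase-space points can be halved, as `d` is odd. -/
theorem half_smul_add_self (hd : Odd d) (u : PhaseSpace d n) : half d • u + half d • u = u := by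
  rw [← two_smul (ZMod d), smul_smul, two_mul_half hd, one_smul]

theorem eq_of_add_self_eq (hd : Odd d) {u v : PhaseSpace d n} (h : u + u = v + v) : u = v := by
  rw [← half_smul_add_self hd u, ← half_smul_add_self hd v, ← smul_add, h, smul_add]

/-- The symplectic form on phase space. -/
def symp (u v : PhaseSpace d n) : ZMod d := u.1 ⬝ᵥ v.2 - v.1 ⬝ᵥ u.2

theorem symp_self (u : PhaseSpace d n) : symp u u = 0 := sub_self _

theorem symp_neg_right (u v : PhaseSpace d n) : symp u (-v) = -symp u v := by
  simp [symp]; ring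

theorem symp_swap (u v : PhaseSpace d n) : symp v u = -symp u v := by
  simp [symp]

/-- The symplectic form is nondegenerate. -/
theorem eq_of_symp_eq {u v : PhaseSpace d n} (h : ∀ x, symp u x = symp v x) : u = v := by
  refine Prod.ext (funext fun k => ?_) (funext fun k => ?_)
  · simpa [symp] using h (0, Pi.single k 1)
  · simpa [symp] using h (Pi.single k 1, 0)

variable [NeZero d]

/-! ### Heisenberg–Weyl operators -/

theorem stdAddChar_sum {ι : Type*} (s : Finset ι) (f : ι → ZMod d) :
    ZMod.stdAddChar (∑ k ∈ s, f k) = ∏ k ∈ s, (ZMod.stdAddChar (f k) : ℂ) :=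
  map_prod (ZMod.stdAddChar (N := d)).toMonoidHom (fun k => Multiplicative.ofAdd (f k)) s

theorem omega_pow (m : ℕ) : omega d ^ m = ZMod.stdAddChar (m : ZMod d) := by
  have h := ZMod.stdAddChar_coe (N := d) (m : ℤ)
  push_cast at h
  rw [h, omega, ← Complex.exp_nat_mul]
  congr 1
  ring

/-- For odd `d`, `τ = ω^{1/2}` with `1/2` taken modulo `d`. -/
theorem tau_eq (hd : Odd d) : tau d = ZMod.stdAddChar (half d) := by
  have h := ZMod.stdAddChar_coe (N := d) (((d + 1) / 2 : ℕ) : ℤ)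
  rw [Int.cast_natCast] at h
  rw [half, h, tau]
  have h2 : (2 : ℂ) * (((d + 1) / 2 : ℕ) : ℂ) = d + 1 := by
    obtain ⟨k, rfl⟩ := hd
    have h : (2 * k + 1 + 1) / 2 = k + 1 := by omega
    rw [h]; push_cast; ring
  congr 1
  rw [Int.cast_natCast, ← h2]
  ring

theorem shiftX_pow_apply (m : ℕ) (i j : ZMod d) :
    (shiftX d ^ m) i j = if i = j + m then 1 else 0 := by
  induction m generalizing i j with
  | zero => simp [Matrix.one_apply]
  | succ m ih =>
    have hs (k l : ZMod d) : shiftX d k l = if k = l + 1 then 1 else 0 := rfl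
    rw [pow_succ, Matrix.mul_apply]
    simp only [ih, hs, mul_ite, mul_one, mul_zero, Finset.sum_ite_eq', Finset.mem_univ, if_true]
    push_cast
    rw [add_assoc, add_comm 1 (m : ZMod d)]

theorem weyl₁_apply (hd : Odd d) (a b i j : ZMod d) :
    weyl₁ d a b i j = if i = j + b then ZMod.stdAddChar (half d * (a * (i + j))) else 0 := by
  rw [weyl₁, Matrix.smul_apply, boostZ, Matrix.diagonal_pow, Matrix.diagonal_mul,
    shiftX_pow_apply, ZMod.natCast_zmod_val, _root_.zpow_neg, zpow_natCast, tau_eq hd,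
    ← AddChar.map_nsmul_eq_pow, ← AddChar.map_neg_eq_inv, Pi.pow_apply, ← pow_mul, omega_pow,
    smul_eq_mul]
  split_ifs with h
  · rw [mul_one, ← AddChar.map_add_eq_mul]
    congr 1
    simp only [nsmul_eq_mul, Nat.cast_mul, ZMod.natCast_zmod_val, h]
    linear_combination (-(a * j + a * b)) * two_mul_half hd
  · simp

/-- The matrix entries of the Weyl operators; with the phase split evenly between the row and the
column label, the prefactor `τ^(-a·b)` disappears. -/
theorem weyl_apply (hd : Odd d) (u : PhaseSpace d n) (i j : Label d n) :
    weyl u i j =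
      if i = j + u.2 then ZMod.stdAddChar (half d * (u.1 ⬝ᵥ (i + j))) else 0 := by
  simp only [weyl, Matrix.of_apply, weyl₁_apply hd]
  split_ifs with h
  · rw [dotProduct, Finset.mul_sum, stdAddChar_sum]
    refine Finset.prod_congr rfl fun k _ => ?_
    rw [if_pos (by rw [h]; rfl), Pi.add_apply]
  · obtain ⟨k, hk⟩ := Function.ne_iff.mp h
    exact Finset.prod_eq_zero (Finset.mem_univ k) (if_neg hk)

theorem weyl_mul (hd : Odd d) (u v : PhaseSpace d n) :
    weyl u * weyl v = ZMod.stdAddChar (half d * symp u v) • weyl (u + v) := by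
  ext i j
  simp only [Matrix.mul_apply, Matrix.smul_apply, weyl_apply hd, mul_ite, mul_zero,
    Finset.sum_ite_eq', Finset.mem_univ, if_true, smul_eq_mul, Prod.fst_add, Prod.snd_add]
  have hc : i = j + v.2 + u.2 ↔ i = j + (u.2 + v.2) := by
    rw [add_assoc, add_comm v.2]
  simp only [ite_mul, zero_mul, hc]
  split_ifs with h
  · rw [← AddChar.map_add_eq_mul, ← AddChar.map_add_eq_mul]
    congr 1
    subst h
    simp only [symp, dotProduct_add, add_dotProduct]
    ring
  · rfl

theorem weyl_conjTranspose (hd : Odd d) (u : PhaseSpace d n) : (weyl u)ᴴ = weyl (-u) := by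
  ext i j
  rw [Matrix.conjTranspose_apply, weyl_apply hd, weyl_apply hd]
  have hc : j = i + u.2 ↔ i = j + (-u).2 := by
    rw [Prod.snd_neg, ← sub_eq_add_neg, eq_sub_iff_add_eq, eq_comm]
  simp only [hc]
  split_ifs with h
  · rw [Complex.star_def, ← AddChar.map_neg_eq_conj, Prod.fst_neg, neg_dotProduct, add_comm j,
      mul_neg]
  · simp

theorem weyl_zero (hd : Odd d) : weyl (0 : PhaseSpace d n) = 1 := by
  ext i j
  simp [weyl_apply hd, Matrix.one_apply]

theorem weyl_mul_neg (hd : Odd d) (u : PhaseSpace d n) : weyl u * weyl (-u) = 1 := by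
  rw [weyl_mul hd, symp_neg_right, symp_self]
  simp [weyl_zero hd]

theorem weyl_neg_mul (hd : Odd d) (u : PhaseSpace d n) : weyl (-u) * weyl u = 1 := by
  simpa using weyl_mul_neg hd (-u)

/-- The Weyl commutation relation. -/
theorem weyl_mul_comm (hd : Odd d) (u v : PhaseSpace d n) :
    weyl u * weyl v = ZMod.stdAddChar (symp u v) • (weyl v * weyl u) := by
  rw [weyl_mul hd, weyl_mul hd, smul_smul, ← AddChar.map_add_eq_mul, add_comm v u, symp_swap u v]
  congr 2
  linear_combination (symp u v) * two_mul_half hd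

theorem weyl_ne_zero (hd : Odd d) (u : PhaseSpace d n) : weyl u ≠ 0 := fun h => by
  have := weyl_mul_neg hd u
  rw [h, zero_mul] at this
  exact zero_ne_one this

theorem eq_stdAddChar_of_weyl_mul_eq (hd : Odd d) {u x : PhaseSpace d n} {k : ℂ}
    (h : weyl u * weyl x = k • (weyl x * weyl u)) : k = ZMod.stdAddChar (symp u x) := by
  rw [weyl_mul_comm hd] at h
  refine (smul_left_injective ℂ (fun h0 : weyl x * weyl u = 0 => weyl_ne_zero hd u ?_) h).symm
  rw [← one_mul (weyl u), ← weyl_neg_mul hd x, Matrix.mul_assoc, h0, mul_zero]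

/-- Weyl operators at different phase-space points are not proportional: the commutation phases
with all other Weyl operators tell them apart. -/
theorem eq_of_weyl_eq_smul (hd : Odd d) {u v : PhaseSpace d n} {c : ℂ}
    (h : weyl u = c • weyl v) : u = v := by
  refine eq_of_symp_eq fun x => ZMod.injective_stdAddChar ?_
  refine (eq_stdAddChar_of_weyl_mul_eq hd ?_).symm
  rw [h, Matrix.smul_mul, weyl_mul_comm hd v x, Matrix.mul_smul, smul_comm]

/-- Only the identity among the Weyl operators commutes with all of them. -/
theorem eq_zero_of_weyl_mul_comm (hd : Odd d) {u : PhaseSpace d n}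
    (h : ∀ x, weyl u * weyl x = weyl x * weyl u) : u = 0 := by
  -- A commuting Weyl operator has the same commutation phases as `T_0`, all equal to one.
  refine eq_of_symp_eq fun x => ZMod.injective_stdAddChar ?_
  rw [← eq_stdAddChar_of_weyl_mul_eq hd (k := 1) (by rw [one_smul, h x])]
  simp [symp]

/-- An operator with nonzero trace that commutes with a Weyl operator up to a scalar commutes
with it: conjugation by the Weyl operator preserves the trace and so forces the scalar to be one. -/
theorem mul_weyl_comm_of_trace_ne_zero (hd : Odd d) {M : Operator d n} {x : PhaseSpace d n} {k : ℂ}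
    (h : M * weyl x = k • (weyl x * M)) (ht : M.trace ≠ 0) : M * weyl x = weyl x * M := by
  have h1 : M.trace = k * M.trace := by
    calc M.trace = (M * weyl x * weyl (-x)).trace := by
          rw [Matrix.mul_assoc, weyl_mul_neg hd, mul_one]
      _ = _ := by
          rw [h, Matrix.smul_mul, Matrix.trace_smul, Matrix.trace_mul_comm,
            ← Matrix.mul_assoc, weyl_neg_mul hd, one_mul, smul_eq_mul]
  have hk : k = 1 := mul_right_cancel₀ ht (by rw [one_mul]; exact h1.symm)
  rw [h, hk, one_smul]

theorem trace_weyl_of_ne_zero (hd : Odd d) {u : PhaseSpace d n} (hu : u ≠ 0) :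
    (weyl u).trace = 0 := by
  by_contra ht
  exact hu (eq_zero_of_weyl_mul_comm hd fun x =>
    mul_weyl_comm_of_trace_ne_zero hd (weyl_mul_comm hd u x) ht)

/-! ### Parity and phase-space point operators -/

/-- The parity operator `|j⟩ ↦ |-j⟩`. -/
def parity (d n : ℕ) : Operator d n := Matrix.of fun i j => if i = -j then 1 else 0

/-- Orthogonality of the characters of `ℤ_d^n`. -/
theorem sum_stdAddChar_dotProduct (w : Label d n) :
    ∑ a : Label d n, (ZMod.stdAddChar (a ⬝ᵥ w) : ℂ) = if w = 0 then (d : ℂ) ^ n else 0 := by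
  let φ : Label d n →+ ZMod d :=
    { toFun := fun a => a ⬝ᵥ w
      map_zero' := zero_dotProduct w
      map_add' := fun a b => add_dotProduct a b w }
  have hφ : ZMod.stdAddChar.compAddMonoidHom φ = (0 : AddChar (Label d n) ℂ) ↔ w = 0 := by
    refine ⟨fun h => funext fun k => ?_, fun h => ?_⟩
    · have h1 := DFunLike.congr_fun h (Pi.single k 1)
      rw [AddChar.compAddMonoidHom_apply, AddChar.zero_apply,
        ← AddChar.map_zero_eq_one (ZMod.stdAddChar (N := d))] at h1
      simpa [φ] using ZMod.injective_stdAddChar h1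
    · ext a
      simp [φ, h]
  have h := AddChar.sum_eq_ite (ZMod.stdAddChar.compAddMonoidHom φ : AddChar (Label d n) ℂ)
  simp only [hφ, Fintype.card_fun, ZMod.card, Fintype.card_fin, Nat.cast_pow] at h
  rw [← h]
  rfl

/-- The sum of all Weyl operators is the parity operator, up to normalisation. -/
theorem phasePointZero_eq_parity (hd : Odd d) : phasePointZero d n = parity d n := by
  ext i j
  have hc (b : Label d n) : i = j + b ↔ b = i - j := by
    rw [eq_sub_iff_add_eq', eq_comm]
  have hw (a : Label d n) : half d * (a ⬝ᵥ (i + j)) = a ⬝ᵥ (half d • (i + j)) := by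
    rw [dotProduct_smul, smul_eq_mul]
  have h0 : half d • (i + j) = 0 ↔ i = -j := by
    rw [← add_eq_zero_iff_eq_neg]
    refine ⟨fun h => ?_, fun h => by rw [h, smul_zero]⟩
    rw [← one_smul (ZMod d) (i + j), ← two_mul_half hd, mul_smul, h, smul_zero]
  rw [phasePointZero, Matrix.smul_apply, Matrix.sum_apply, Fintype.sum_prod_type]
  simp only [weyl_apply hd, hc, Finset.sum_ite_eq', Finset.mem_univ, if_true, hw]
  rw [sum_stdAddChar_dotProduct]
  have hdn : (d : ℂ) ^ n ≠ 0 := pow_ne_zero _ (Nat.cast_ne_zero.mpr (NeZero.ne d))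
  simp only [h0, parity, Matrix.of_apply, smul_ite, smul_zero]
  simp [hdn]

theorem parity_mul_apply (M : Operator d n) (i j : Label d n) :
    (parity d n * M) i j = M (-i) j := by
  have hp (k : Label d n) : parity d n i k = if k = -i then 1 else 0 :=
    if_congr (by rw [eq_comm, neg_eq_iff_eq_neg]) rfl rfl
  simp [Matrix.mul_apply, hp]

theorem mul_parity_apply (M : Operator d n) (i j : Label d n) :
    (M * parity d n) i j = M i (-j) := by
  simp [Matrix.mul_apply, parity]

theorem parity_mul_weyl (hd : Odd d) (u : PhaseSpace d n) :
    parity d n * weyl u = weyl (-u) * parity d n := by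
  ext i j
  have hc : -i = j + u.2 ↔ i = -j + (-u).2 := by
    rw [Prod.snd_neg, neg_eq_iff_eq_neg, neg_add]
  rw [parity_mul_apply, mul_parity_apply, weyl_apply hd, weyl_apply hd]
  simp only [hc]
  split_ifs with h
  · congr 2
    rw [Prod.fst_neg, neg_dotProduct, ← dotProduct_neg, neg_add, neg_neg]
  · rfl

theorem parity_mul_parity : parity d n * parity d n = 1 := by
  ext i j
  simp [Matrix.mul_apply, parity, Matrix.one_apply]

/-- As parity reflects Weyl operators, `T_u P T_u† = T_u T_u P = T_{2u} P`. -/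
theorem phasePoint_eq (hd : Odd d) (u : PhaseSpace d n) :
    phasePoint u = weyl (u + u) * parity d n := by
  rw [phasePoint, phasePointZero_eq_parity hd, weyl_conjTranspose hd, Matrix.mul_assoc,
    parity_mul_weyl hd, neg_neg, ← Matrix.mul_assoc, weyl_mul hd, symp_self]
  simp

/-- A product of two phase-space point operators is proportional to `T_{2u - 2v}`. -/
theorem phasePoint_mul (hd : Odd d) (u v : PhaseSpace d n) :
    phasePoint u * phasePoint v = weyl (u + u) * weyl (-(v + v)) := by
  rw [phasePoint_eq hd, phasePoint_eq hd, Matrix.mul_assoc, ← Matrix.mul_assoc (parity d n),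
    parity_mul_weyl hd, Matrix.mul_assoc, parity_mul_parity, mul_one]

theorem phasePoint_mul_self (hd : Odd d) (u : PhaseSpace d n) :
    phasePoint u * phasePoint u = 1 := by
  rw [phasePoint_mul hd, weyl_mul_neg hd]

theorem phasePoint_mul_zero (hd : Odd d) (u : PhaseSpace d n) :
    phasePoint u * phasePoint 0 = weyl (u + u) := by
  rw [phasePoint_mul hd]
  simp [weyl_zero hd]

theorem trace_phasePoint_mul_of_ne (hd : Odd d) {u v : PhaseSpace d n} (h : u ≠ v) :
    (phasePoint u * phasePoint v).trace = 0 := by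
  rw [phasePoint_mul hd, weyl_mul hd, Matrix.trace_smul, trace_weyl_of_ne_zero hd, smul_zero]
  exact fun h0 => h (eq_of_add_self_eq hd (add_neg_eq_zero.mp h0))

theorem trace_phasePoint_mul_self (hd : Odd d) (u : PhaseSpace d n) :
    (phasePoint u * phasePoint u).trace = (d : ℂ) ^ n := by
  rw [phasePoint_mul_self hd, Matrix.trace_one]
  simp

theorem card_phaseSpace : Fintype.card (PhaseSpace d n) = d ^ (2 * n) := by
  simp [two_mul, pow_add]

/-! ### Expansion in phase-space point operators -/

/-- The phase-space point operators are orthogonal for the trace form. -/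
theorem linearIndependent_phasePoint (hd : Odd d) :
    LinearIndependent ℂ (phasePoint : PhaseSpace d n → Operator d n) := by
  rw [Fintype.linearIndependent_iff]
  intro c hc v
  have h : (phasePoint v * ∑ u, c u • phasePoint u).trace = c v * (d : ℂ) ^ n := by
    rw [Matrix.mul_sum, Matrix.trace_sum, Finset.sum_eq_single v]
    · rw [Matrix.mul_smul, Matrix.trace_smul, trace_phasePoint_mul_self hd, smul_eq_mul]
    · intro u _ hu
      rw [Matrix.mul_smul, Matrix.trace_smul, trace_phasePoint_mul_of_ne hd hu.symm, smul_zero]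
    · simp
  rw [hc, mul_zero, Matrix.trace_zero] at h
  exact (mul_eq_zero.mp h.symm).resolve_right
    (pow_ne_zero _ (Nat.cast_ne_zero.mpr (NeZero.ne d)))

/-- There are `d ^ (2 * n)` phase-space point operators, so being independent they span. -/
theorem span_phasePoint (hd : Odd d) :
    Submodule.span ℂ (Set.range (phasePoint : PhaseSpace d n → Operator d n)) = ⊤ := by
  refine (linearIndependent_phasePoint hd).span_eq_top_of_card_eq_finrank' ?_
  rw [card_phaseSpace, Module.finrank_matrix]
  simp [two_mul, pow_add]

/-- An operator is the combination of phase-space point operators whose coefficients are its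
normalised traces against them. -/
theorem eq_sum_phasePoint (hd : Odd d) (B : Operator d n) :
    B = ∑ v, (1 / (d : ℂ) ^ n * (phasePoint v * B).trace) • phasePoint v := by
  have hdn : (d : ℂ) ^ n ≠ 0 := pow_ne_zero _ (Nat.cast_ne_zero.mpr (NeZero.ne d))
  have hB : B ∈ Submodule.span ℂ (Set.range (phasePoint : PhaseSpace d n → Operator d n)) := by
    rw [span_phasePoint hd]; trivial
  induction hB using Submodule.span_induction with
  | mem B hB =>
    obtain ⟨u, rfl⟩ := hB
    rw [Finset.sum_eq_single u]
    · rw [trace_phasePoint_mul_self hd, one_div_mul_cancel hdn, one_smul]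
    · intro v _ hv
      rw [trace_phasePoint_mul_of_ne hd hv, mul_zero, zero_smul]
    · simp
  | zero => simp
  | add B C _ _ hB hC =>
    simp only [Matrix.trace_add, mul_add, add_smul, Finset.sum_add_distrib]
    rw [← hB, ← hC]
  | smul c B _ hB =>
    conv_lhs => rw [hB]
    simp only [Matrix.mul_smul, Matrix.trace_smul, Finset.smul_sum, smul_smul, smul_eq_mul,
      mul_left_comm]

/-- Each phase-space point operator reflects all Weyl operators, up to scalars: conjugation by it
sends `T_x` to a multiple of `T_{-x}`. -/
theorem phasePoint_mul_weyl (hd : Odd d) (u x : PhaseSpace d n) :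
    ∃ c : ℂ, phasePoint u * weyl x = c • (weyl (-x) * phasePoint u) := by
  refine ⟨ZMod.stdAddChar (symp (u + u) (-x)), ?_⟩
  rw [phasePoint_eq hd, Matrix.mul_assoc, parity_mul_weyl hd, ← Matrix.mul_assoc,
    weyl_mul_comm hd, Matrix.smul_mul, Matrix.mul_assoc]

/-! ### Wigner functions of unitary channels -/

/-- Conjugation by a unitary is multiplicative. -/
theorem conj_mul_conj {U : Operator d n} (hU : Uᴴ * U = 1) (A B : Operator d n) :
    U * A * Uᴴ * (U * B * Uᴴ) = U * (A * B) * Uᴴ := by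
  calc U * A * Uᴴ * (U * B * Uᴴ) = U * A * (Uᴴ * U) * B * Uᴴ := by simp only [Matrix.mul_assoc]
    _ = _ := by rw [hU, mul_one, Matrix.mul_assoc U]

theorem conj_phasePoint_mul_self (hd : Odd d) {U : Operator d n} (hU : Uᴴ * U = 1)
    (hU' : U * Uᴴ = 1) (u : PhaseSpace d n) :
    U * phasePoint u * Uᴴ * (U * phasePoint u * Uᴴ) = 1 := by
  rw [conj_mul_conj hU, phasePoint_mul_self hd, mul_one, hU']

theorem channelWigner_conjChannel (U : Operator d n) (v u : PhaseSpace d n) :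
    channelWigner (conjChannel U) v u =
      1 / (d : ℂ) ^ n * (phasePoint v * (U * phasePoint u * Uᴴ)).trace := by
  rw [channelWigner, conjChannel_apply]

/-- The image of a phase-space point operator under a channel, expanded with the corresponding
column of the Wigner function as coefficients. -/
theorem conj_phasePoint_eq_sum (hd : Odd d) (U : Operator d n) (u : PhaseSpace d n) :
    U * phasePoint u * Uᴴ = ∑ v, channelWigner (conjChannel U) v u • phasePoint v := by
  simp only [channelWigner_conjChannel]
  exact eq_sum_phasePoint hd _

/-- The operator `U A_u U†` squares to one, so it is not zero and some coefficient of it is not. -/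
theorem exists_channelWigner_ne_zero (hd : Odd d) {U : Operator d n} (hU : Uᴴ * U = 1)
    (hU' : U * Uᴴ = 1) (u : PhaseSpace d n) : ∃ v, channelWigner (conjChannel U) v u ≠ 0 := by
  by_contra! h
  have h1 := conj_phasePoint_mul_self hd hU hU' u
  rw [conj_phasePoint_eq_sum hd] at h1
  simp [h] at h1

/-- Every column of the Wigner function of a unitary channel has a nonzero entry, so the second
projection maps the Wigner set onto phase space. -/
theorem image_snd_wignerSet (hd : Odd d) {U : Operator d n} (hU : Uᴴ * U = 1)
    (hU' : U * Uᴴ = 1) : Prod.snd '' wignerSet (conjChannel U) = Set.univ := by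
  refine Set.eq_univ_of_forall fun u => ?_
  obtain ⟨v, hv⟩ := exists_channelWigner_ne_zero hd hU hU' u
  exact ⟨(v, u), hv, rfl⟩

theorem le_wignerRank (hd : Odd d) {U : Operator d n} (hU : Uᴴ * U = 1) (hU' : U * Uᴴ = 1) :
    d ^ (2 * n) ≤ wignerRank (conjChannel U) := by
  have h := Set.ncard_image_le (f := Prod.snd) (Set.toFinite (wignerSet (conjChannel U)))
  rwa [image_snd_wignerSet hd hU hU', Set.ncard_univ, Nat.card_eq_fintype_card,
    card_phaseSpace] at h

theorem wignerRank_eq_iff (hd : Odd d) {U : Operator d n} (hU : Uᴴ * U = 1) (hU' : U * Uᴴ = 1) :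
    wignerRank (conjChannel U) = d ^ (2 * n) ↔
      Set.InjOn Prod.snd (wignerSet (conjChannel U)) := by
  rw [← Set.ncard_image_iff, image_snd_wignerSet hd hU hU', Set.ncard_univ,
    Nat.card_eq_fintype_card, card_phaseSpace, eq_comm, wignerRank]

theorem logWignerRank_nonneg_of_le {N : Operator d n →ₗ[ℂ] Operator d n}
    (h : d ^ (2 * n) ≤ wignerRank N) : 0 ≤ logWignerRank N := by
  have hd0 : (0 : ℝ) < (d : ℝ) ^ (2 * n) := pow_pos (Nat.cast_pos.mpr (NeZero.pos d)) _
  have h' : (d : ℝ) ^ (2 * n) ≤ wignerRank N := by exact_mod_cast h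
  exact sub_nonneg.mpr (Real.logb_le_logb_of_le one_lt_two hd0 h')

theorem logWignerRank_eq_zero_iff {N : Operator d n →ₗ[ℂ] Operator d n}
    (h : d ^ (2 * n) ≤ wignerRank N) : logWignerRank N = 0 ↔ wignerRank N = d ^ (2 * n) := by
  have hd0 : (0 : ℝ) < (d : ℝ) ^ (2 * n) := pow_pos (Nat.cast_pos.mpr (NeZero.pos d)) _
  have h' : (d : ℝ) ^ (2 * n) ≤ wignerRank N := by exact_mod_cast h
  rw [logWignerRank, sub_eq_zero,
    (Real.logb_injOn_pos one_lt_two).eq_iff (Set.mem_Ioi.mpr (hd0.trans_le h')) hd0]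
  exact_mod_cast Iff.rfl

/-! ### Minimal Wigner rank implies Clifford -/

/-- If each column of the Wigner function has only one nonzero entry, each phase-space point
operator is mapped to a multiple of one. -/
theorem exists_conj_phasePoint_eq (hd : Odd d) {U : Operator d n} (hU : Uᴴ * U = 1)
    (hU' : U * Uᴴ = 1) (h : Set.InjOn Prod.snd (wignerSet (conjChannel U)))
    (u : PhaseSpace d n) :
    ∃ (c : ℂ) (v : PhaseSpace d n), U * phasePoint u * Uᴴ = c • phasePoint v := by
  obtain ⟨v, hv⟩ := exists_channelWigner_ne_zero hd hU hU' u
  refine ⟨channelWigner (conjChannel U) v u, v, ?_⟩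
  rw [conj_phasePoint_eq_sum hd, Finset.sum_eq_single v]
  · intro w _ hw
    by_contra hne
    have hw0 : channelWigner (conjChannel U) w u ≠ 0 := fun h0 => hne (by rw [h0, zero_smul])
    exact hw (congrArg Prod.fst (@h (w, u) hw0 (v, u) hv rfl))
  · simp

/-- A proportionality factor between a unitarily conjugated Weyl operator and a Weyl operator is a
phase, by unitarity. -/
theorem norm_eq_one_of_conj_weyl_eq (hd : Odd d) {U : Operator d n} (hU : Uᴴ * U = 1)
    (hU' : U * Uᴴ = 1) {u v : PhaseSpace d n} {c : ℂ} (h : U * weyl u * Uᴴ = c • weyl v) :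
    ‖c‖ = 1 := by
  have h1 : (U * weyl u * Uᴴ) * (U * weyl u * Uᴴ)ᴴ = 1 := by
    rw [Matrix.conjTranspose_mul, Matrix.conjTranspose_mul, Matrix.conjTranspose_conjTranspose,
      ← Matrix.mul_assoc U, conj_mul_conj hU, weyl_conjTranspose hd, weyl_mul_neg hd, mul_one, hU']
  rw [h, Matrix.conjTranspose_smul, Matrix.smul_mul, Matrix.mul_smul, weyl_conjTranspose hd,
    weyl_mul_neg hd, smul_smul, Complex.star_def, Complex.mul_conj'] at h1
  have h2 := congrFun (congrFun h1 0) 0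
  simp only [Matrix.smul_apply, Matrix.one_apply_eq, smul_eq_mul, mul_one] at h2
  have h3 : ‖c‖ ^ 2 = 1 := by exact_mod_cast h2
  exact (pow_eq_one_iff_of_nonneg (norm_nonneg c) two_ne_zero).mp h3

/-- Since Weyl operators are products of two phase-space point operators, a unitary that permutes
the latter up to scalars is Clifford. -/
theorem mem_cliffordOperators_of_conj_phasePoint (hd : Odd d) {U : Operator d n}
    (hU : U ∈ Matrix.unitaryGroup (Label d n) ℂ)
    (h : ∀ u, ∃ (c : ℂ) (v : PhaseSpace d n), U * phasePoint u * Uᴴ = c • phasePoint v) :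
    U ∈ cliffordOperators d n := by
  have hU1 : Uᴴ * U = 1 := Matrix.mem_unitaryGroup_iff'.mp hU
  refine ⟨hU, fun u => ?_⟩
  obtain ⟨c, v, hv⟩ := h (half d • u)
  obtain ⟨b, w, hw⟩ := h 0
  have key : U * weyl u * Uᴴ =
      (c * b * ZMod.stdAddChar (half d * symp (v + v) (-(w + w)))) •
        weyl (v + v + -(w + w)) := by
    rw [← half_smul_add_self hd u, ← phasePoint_mul_zero hd, ← conj_mul_conj hU1, hv, hw,
      Matrix.smul_mul, Matrix.mul_smul, phasePoint_mul hd, weyl_mul hd, smul_smul, smul_smul,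
      mul_assoc]
  have hn := norm_eq_one_of_conj_weyl_eq hd hU1 (Matrix.mem_unitaryGroup_iff.mp hU) key
  obtain ⟨θ, hθ⟩ := (Complex.norm_eq_one_iff _).mp hn
  exact ⟨θ, _, by rw [hθ]; exact key⟩

/-! ### Clifford operators have minimal Wigner rank -/

/-- A Clifford operator permutes the phase-space points: each Weyl operator is hit, up to a
nonzero scalar, by conjugation of some Weyl operator. -/
theorem exists_conj_weyl_eq_of_clifford (hd : Odd d) {U : Operator d n}
    (hU : U ∈ cliffordOperators d n) (x : PhaseSpace d n) :
    ∃ (c : ℂ) (y : PhaseSpace d n), c ≠ 0 ∧ U * weyl y * Uᴴ = c • weyl x := by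
  obtain ⟨hU0, hC⟩ := hU
  have hU1 : Uᴴ * U = 1 := Matrix.mem_unitaryGroup_iff'.mp hU0
  choose θ f hf using hC
  have hback (u : PhaseSpace d n) :
      weyl u = Complex.exp (θ u * Complex.I) • (Uᴴ * weyl (f u) * U) := by
    calc weyl u = Uᴴ * U * weyl u * (Uᴴ * U) := by rw [hU1, one_mul, mul_one]
      _ = Uᴴ * (U * weyl u * Uᴴ) * U := by simp only [Matrix.mul_assoc]
      _ = _ := by rw [hf, Matrix.mul_smul, Matrix.smul_mul]
  -- An injective self-map of the finite phase space is onto.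
  have hinj : Function.Injective f := fun u v huv => by
    refine eq_of_weyl_eq_smul hd
      (c := Complex.exp (θ u * Complex.I) * (Complex.exp (θ v * Complex.I))⁻¹) ?_
    rw [hback v, smul_smul, inv_mul_cancel_right₀ (Complex.exp_ne_zero _), ← huv]
    exact hback u
  obtain ⟨y, rfl⟩ := Finite.surjective_of_injective hinj x
  exact ⟨_, y, Complex.exp_ne_zero _, hf y⟩

/-- For a Clifford operator `U`, conjugation by `U A_u U†` reflects Weyl operators up to scalars,
just as conjugation by a phase-space point operator does. -/
theorem conj_phasePoint_mul_weyl (hd : Odd d) {U : Operator d n}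
    (hU : U ∈ cliffordOperators d n) (u x : PhaseSpace d n) :
    ∃ c : ℂ, U * phasePoint u * Uᴴ * weyl x = c • (weyl (-x) * (U * phasePoint u * Uᴴ)) := by
  have hU1 : Uᴴ * U = 1 := Matrix.mem_unitaryGroup_iff'.mp hU.1
  obtain ⟨c, y, hc, hy⟩ := exists_conj_weyl_eq_of_clifford hd hU x
  obtain ⟨k, hk⟩ := phasePoint_mul_weyl hd u y
  have hx : weyl x = c⁻¹ • (U * weyl y * Uᴴ) := by rw [hy, inv_smul_smul₀ hc]
  have hy' : U * weyl (-y) * Uᴴ = star c • weyl (-x) := by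
    have h := congrArg Matrix.conjTranspose hy
    rwa [Matrix.conjTranspose_mul, Matrix.conjTranspose_mul, Matrix.conjTranspose_conjTranspose,
      Matrix.conjTranspose_smul, weyl_conjTranspose hd, weyl_conjTranspose hd,
      ← Matrix.mul_assoc] at h
  refine ⟨c⁻¹ * (k * star c), ?_⟩
  rw [hx, Matrix.mul_smul, conj_mul_conj hU1, hk, Matrix.mul_smul, Matrix.smul_mul,
    ← conj_mul_conj hU1, hy', Matrix.smul_mul, smul_smul, smul_smul, mul_assoc c⁻¹]

/-- The reflections by `A_v` and by `U A_u U†` cancel, and the scalar that remains is one because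
the trace of the product is not zero. -/
theorem phasePoint_mul_conj_comm_weyl (hd : Odd d) {U : Operator d n}
    (hU : U ∈ cliffordOperators d n) {u v : PhaseSpace d n}
    (h : channelWigner (conjChannel U) v u ≠ 0) (x : PhaseSpace d n) :
    phasePoint v * (U * phasePoint u * Uᴴ) * weyl x =
      weyl x * (phasePoint v * (U * phasePoint u * Uᴴ)) := by
  obtain ⟨k, hk⟩ := conj_phasePoint_mul_weyl hd hU u x
  obtain ⟨l, hl⟩ := phasePoint_mul_weyl hd v (-x)
  refine mul_weyl_comm_of_trace_ne_zero hd (k := k * l) ?_ ?_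
  · rw [Matrix.mul_assoc, hk, Matrix.mul_smul, ← Matrix.mul_assoc, hl, neg_neg, Matrix.smul_mul,
      smul_smul, Matrix.mul_assoc]
  · rw [channelWigner_conjChannel] at h
    exact right_ne_zero_of_mul h

/-- Two nonzero entries `v`, `w` in one column of the Wigner function of a Clifford channel would
make `A_v A_w`, which is proportional to `T_{2v - 2w}`, commute with all Weyl operators. -/
theorem injOn_snd_wignerSet_of_clifford (hd : Odd d) {U : Operator d n}
    (hU : U ∈ cliffordOperators d n) : Set.InjOn Prod.snd (wignerSet (conjChannel U)) := by
  rintro ⟨v, u⟩ hv ⟨w, _⟩ hw rfl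
  have hB := conj_phasePoint_mul_self hd (Matrix.mem_unitaryGroup_iff'.mp hU.1)
    (Matrix.mem_unitaryGroup_iff.mp hU.1) u
  have hMv := phasePoint_mul_conj_comm_weyl hd hU (u := u) hv
  have hMw := phasePoint_mul_conj_comm_weyl hd hU (u := u) hw
  set B := U * phasePoint u * Uᴴ
  have hinv : phasePoint w * B * (B * phasePoint w) = 1 := by
    rw [Matrix.mul_assoc, ← Matrix.mul_assoc B, hB, one_mul, phasePoint_mul_self hd]
  have hvw : phasePoint v * phasePoint w * (phasePoint w * B) = phasePoint v * B := by
    rw [Matrix.mul_assoc, ← Matrix.mul_assoc (phasePoint w), phasePoint_mul_self hd, one_mul]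
  have hcomm (x : PhaseSpace d n) :
      phasePoint v * phasePoint w * weyl x = weyl x * (phasePoint v * phasePoint w) := by
    have h : phasePoint v * phasePoint w * weyl x * (phasePoint w * B) =
        weyl x * (phasePoint v * phasePoint w) * (phasePoint w * B) := by
      rw [Matrix.mul_assoc, ← hMw, ← Matrix.mul_assoc, hvw, hMv, Matrix.mul_assoc (weyl x), hvw]
    exact (IsUnit.of_mul_eq_one _ hinv).mul_right_cancel h
  have h0 : v + v + -(w + w) = 0 := by
    refine eq_zero_of_weyl_mul_comm hd fun x => ?_
    have h := hcomm x
    rw [phasePoint_mul hd, weyl_mul hd, Matrix.smul_mul, Matrix.mul_smul] at h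
    exact (AddChar.val_isUnit _ _).smul_left_cancel.mp h
  rw [eq_of_add_self_eq hd (add_neg_eq_zero.mp h0)]

end WignerRank

theorem mainTheorem8 (d n : ℕ) [Fact d.Prime] (hd : Odd d)
    (U : WignerRank.Operator d n) (hU : U ∈ Matrix.unitaryGroup (WignerRank.Label d n) ℂ) :
    0 ≤ WignerRank.logWignerRank (WignerRank.conjChannel U) ∧
      (WignerRank.logWignerRank (WignerRank.conjChannel U) = 0 ↔
        U ∈ WignerRank.cliffordOperators d n) := by
  have hU1 : Uᴴ * U = 1 := Matrix.mem_unitaryGroup_iff'.mp hU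
  have hU2 : U * Uᴴ = 1 := Matrix.mem_unitaryGroup_iff.mp hU
  have hle := WignerRank.le_wignerRank hd hU1 hU2
  refine ⟨WignerRank.logWignerRank_nonneg_of_le hle, ?_⟩
  rw [WignerRank.logWignerRank_eq_zero_iff hle, WignerRank.wignerRank_eq_iff hd hU1 hU2]
  exact ⟨fun h => WignerRank.mem_cliffordOperators_of_conj_phasePoint hd hU
      (WignerRank.exists_conj_phasePoint_eq hd hU1 hU2 h),
    WignerRank.injOn_snd_wignerSet_of_clifford hd⟩
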